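/- Let $1<t_0<N_0$ be integers and $\alpha=\log t_0/\log N_0$. For $n_0\in\mathbb N$ put $N=N_0^{2n_0}$, $t=t_0^{2n_0}$ and $[N]=\{0,1,\dots,N-1\}$. Given $A_0=\{0\}$ and, for each $j\ge 0$ and each $a\in A_j$, a set $A_{j+1,a}\subset N^{-(j+1)}[N]$ with $|A_{j+1,a}|=t$, where $$A_{j+1}=\bigcup_{a\in A_j}(a+A_{j+1,a}),$$ let $E_j=\bigcup_{a\in A_j}(a+[0,N^{-j}])$, $E=\bigcap_{j\ge1}E_j$, and let $\mu_j$ be the measure on $\mathbb R$ with density $\sum_{a\in A_j}t^{-j}N^j\mathbf 1_{[a,a+N^{-j}]}$. Given an arithmetic progression $P\subset[N]$ with $t^{1/2}=t_0^{n_0}$ distinct terms, let $P_0=\{0\}$, $P_{j+1}=\bigcup_{a\in P_j}(a+N^{-(j+1)}P)$, $F_j=\bigcup_{a\in P_j}(a+[0,N^{-j}))$ and $f_\ell=\mathbf 1_{F_\ell}$. For a finite measure $\nu$ on $\mathbb R$ write $\widehat\nu(k)=\int e^{-2\pi i kx}\,d\nu(x)$. **Proposition.** For every $n_0$ that is sufficiently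 large (depending on $N_0,t_0$) there are constants $C(\beta,n_0)$ and $C(\beta,\ell,n_0)$ (which may also depend on the fixed $N_0,t_0$, but on nothing else) such that, for every arithmetic progression $P\subset[N]$ of length $t^{1/2}$, the sets $A_{j+1,a}$ can be chosen, as above, so that $P_j\subset A_j$ and $F_j\subset E_j$ for all $j\ge0$, the measures $\mu_j$ converge weakly to a probability measure $\mu$ carried by $E$ (that is, $\mu(\mathbb R\setminus E)=0$), and for every $0<\beta<\alpha$ $$|\widehat{\mu}(k)|\le C(\beta,n_0)\,|k|^{-\beta/2}\qquad(k\in\mathbb Z\setminus\{0\}),$$ $$|\widehat{f_\ell\mu_j}(k)|\le C(\beta,\ell,n_0)\,|k|^{-\beta/2}\qquad(k\in\mathbb Z\setminus\{0\},\ \ell\ge 0,\ j\ge\ell).$$ -/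

import Mathlib

open MeasureTheory Filter Topology

noncomputable section

namespace SalemCantor

/-- The grid `N^{-j} [N] = {0, N^{-j}, …, (N - 1) N^{-j}}`, where `[N] = {0, 1, …, N - 1}`. -/
def grid (N j : ℕ) : Finset ℝ :=
  (Finset.range N).image fun m : ℕ => (m : ℝ) / (N : ℝ) ^ j

/-- The sets `A_j` of left endpoints of a Cantor iteration, built from a choice `D` of digit sets,
where `D (j + 1) a` is the set `A_{j+1,a}`:
`A_0 = {0}` and `A_{j+1} = ⋃_{a ∈ A_j} (a + A_{j+1,a})`. -/
def endpoints (D : ℕ → ℝ → Finset ℝ) : ℕ → Finset ℝ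
  | 0 => {0}
  | j + 1 => (endpoints D j).biUnion fun a => (D (j + 1) a).image fun b => a + b

/-- The requirement on the choice of the sets `A_{j+1,a}`, `a ∈ A_j`: they are subsets of
`N^{-(j+1)} [N]` with exactly `t` elements. -/
def IsAdmissible (N t : ℕ) (D : ℕ → ℝ → Finset ℝ) : Prop :=
  ∀ j : ℕ, ∀ a ∈ endpoints D j, D (j + 1) a ⊆ grid N (j + 1) ∧ (D (j + 1) a).card = t

/-- The sets `E_j = ⋃_{a ∈ A_j} a + [0, N^{-j}]`. -/
def level (N : ℕ) (D : ℕ → ℝ → Finset ℝ) (j : ℕ) : Set ℝ :=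
  ⋃ a ∈ endpoints D j, Set.Icc a (a + 1 / (N : ℝ) ^ j)

/-- The Cantor set `E = ⋂_{j ≥ 1} E_j`. -/
def cantorSet (N : ℕ) (D : ℕ → ℝ → Finset ℝ) : Set ℝ :=
  ⋂ j ≥ 1, level N D j

/-- The density `∑_{a ∈ A_j} t^{-j} N^j 1_{[a, a + N^{-j}]}`. -/
def density (N t : ℕ) (D : ℕ → ℝ → Finset ℝ) (j : ℕ) (x : ℝ) : ℝ :=
  ∑ a ∈ endpoints D j, ((t : ℝ) ^ j)⁻¹ * (N : ℝ) ^ j *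
    (Set.Icc a (a + 1 / (N : ℝ) ^ j)).indicator (fun _ => (1 : ℝ)) x

/-- The absolutely continuous measure `μ_j` with the above density. -/
def levelMeasure (N t : ℕ) (D : ℕ → ℝ → Finset ℝ) (j : ℕ) : Measure ℝ :=
  volume.withDensity fun x => ENNReal.ofReal (density N t D j x)

/-- `μ` is a weak limit of the measures `ν j`: integrals of bounded continuous functions
converge. -/
def IsWeakLimit (ν : ℕ → Measure ℝ) (μ : Measure ℝ) : Prop :=
  ∀ g : BoundedContinuousFunction ℝ ℝ,
    Tendsto (fun j => ∫ x, g x ∂(ν j)) atTop (𝓝 (∫ x, g x ∂μ))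

/-- `P` is an arithmetic progression with exactly `L` (distinct) terms. -/
def IsArithProg (P : Finset ℕ) (L : ℕ) : Prop :=
  ∃ x d : ℕ, 0 < d ∧ P = (Finset.range L).image fun i => x + i * d

/-- The structured sets: `P_0 = {0}` and `P_{j+1} = ⋃_{a ∈ P_j} (a + N^{-(j+1)} P)`. -/
def structured (N : ℕ) (P : Finset ℕ) : ℕ → Finset ℝ
  | 0 => {0}
  | j + 1 => (structured N P j).biUnion fun a =>
      P.image fun p : ℕ => a + (p : ℝ) / (N : ℝ) ^ (j + 1)

/-- The sets `F_j = ⋃_{a ∈ P_j} a + [0, N^{-j})`. -/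
def structuredLevel (N : ℕ) (P : Finset ℕ) (j : ℕ) : Set ℝ :=
  ⋃ a ∈ structured N P j, Set.Ico a (a + 1 / (N : ℝ) ^ j)

/-- The characteristic function `f_ℓ` of `F_ℓ`. -/
def charFn (N : ℕ) (P : Finset ℕ) (l : ℕ) : ℝ → ℝ :=
  (structuredLevel N P l).indicator fun _ => 1

/-- The Fourier transform `∫ e^{-2πi ξ x} dμ(x)` of a measure `μ` on `ℝ`. -/
def fourierMeasure (μ : Measure ℝ) (ξ : ℝ) : ℂ :=
  ∫ x, Complex.exp (-2 * Real.pi * Complex.I * ξ * x) ∂μ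

/-- The Fourier transform `∫ f(x) e^{-2πi ξ x} dμ(x)` of the measure `f dμ`. -/
def fourierWeighted (f : ℝ → ℝ) (μ : Measure ℝ) (ξ : ℝ) : ℂ :=
  ∫ x, (f x : ℂ) * Complex.exp (-2 * Real.pi * Complex.I * ξ * x) ∂μ

end SalemCantor

end


/-!
The sets `A_{j+1,a}` are chosen one level at a time. At level `j` the random choice puts at each
endpoint a uniformly random cyclic interval of `t` digits; the sum over the endpoints of the
deviations of the exponential sums from their means is then a sum of independent centred variables,
so its exponential moments factorise, and some choice makes it `O((j + 1) log N * t ^ (j / 2))`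
simultaneously for all frequencies, which matter only modulo `N ^ (j + 1)`, and also for the sums
restricted to the endpoints in `F_l`, for all `l ≤ j`.
The progression `P` costs nothing: only the endpoints in `P_j` need digit sets containing `P`, and
there are at most `t ^ (j / 2)` of these, so the trivial bound for their terms suffices.

Passing from level `j` to level `j + 1` thus changes the Fourier transform at `k` by at most
`t ^ (-j) * O((j + 1) t ^ (j / 2))` times the mean of a character over an interval of length
`N ^ (-(j + 1))`, which is at most `(N ^ (j + 1) / |k|) ^ (β / 2)`. The sum over `j` converges since
`N ^ (β / 2) < t ^ (1 / 2)`.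
-/

namespace SalemCantor

open Finset

open scoped BigOperators

section RandomChoice

variable {ι Ω τ : Type*}

theorem sum_exp_mul_le {O : Finset Ω} {v : Ω → ℝ} (hv : ∀ y ∈ O, |v y| ≤ 1)
    (hmean : ∑ y ∈ O, v y = 0) (c : ℝ) :
    ∑ y ∈ O, Real.exp (c * v y) ≤ #O * Real.exp (c ^ 2 / 2) :=
  calc ∑ y ∈ O, Real.exp (c * v y)
      ≤ ∑ y ∈ O, (Real.cosh c + v y * Real.sinh c) := by
        gcongr with y hy
        rw [mul_comm]
        exact Real.exp_mul_le_cosh_add_mul_sinh (hv y hy) c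
    _ = #O * Real.cosh c := by
        rw [sum_add_distrib, ← sum_mul, hmean, zero_mul, add_zero, sum_const, nsmul_eq_mul]
    _ ≤ #O * Real.exp (c ^ 2 / 2) := by gcongr; exact Real.cosh_le_exp_half_sq c

variable [Fintype ι]

theorem exists_choice_sum_exp_le {O : Finset Ω} (hO : O.Nonempty) (T : Finset τ)
    {v : τ → ι → Ω → ℝ} (hv : ∀ r ∈ T, ∀ i, ∀ y ∈ O, |v r i y| ≤ 1)
    (hmean : ∀ r ∈ T, ∀ i, ∑ y ∈ O, v r i y = 0) (c : ℝ) :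
    ∃ x : ι → Ω, (∀ i, x i ∈ O) ∧ ∑ r ∈ T, Real.exp (c * ∑ i, v r i (x i)) ≤
      #T * Real.exp (c ^ 2 / 2) ^ Fintype.card ι := by
  classical
  -- The average over all choices factorises, because the coordinates of a choice are independent.
  have average : ∑ x ∈ Fintype.piFinset fun _ : ι => O, ∑ r ∈ T, Real.exp (c * ∑ i, v r i (x i)) ≤
      ∑ _x ∈ Fintype.piFinset fun _ : ι => O, #T * Real.exp (c ^ 2 / 2) ^ Fintype.card ι :=
    calc ∑ x ∈ Fintype.piFinset fun _ : ι => O, ∑ r ∈ T, Real.exp (c * ∑ i, v r i (x i))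
        = ∑ r ∈ T, ∏ i, ∑ y ∈ O, Real.exp (c * v r i y) := by
          simp_rw [prod_univ_sum, mul_sum, Real.exp_sum]
          exact sum_comm
      _ ≤ ∑ _r ∈ T, ∏ _i : ι, #O * Real.exp (c ^ 2 / 2) := by
          gcongr with r hr i
          exact sum_exp_mul_le (hv r hr i) (hmean r hr i) c
      _ = _ := by
          simp only [prod_const, card_univ, sum_const, nsmul_eq_mul, mul_pow,
            Fintype.card_piFinset, Nat.cast_pow]
          ring
  obtain ⟨x, hx, hle⟩ := exists_le_of_sum_le (Fintype.piFinset_nonempty.2 fun _ => hO) average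
  exact ⟨x, Fintype.mem_piFinset.1 hx, hle⟩

theorem exists_choice_sum_le {O : Finset Ω} (hO : O.Nonempty) (T : Finset τ)
    {v : τ → ι → Ω → ℝ} (hv : ∀ r ∈ T, ∀ i, ∀ y ∈ O, |v r i y| ≤ 1)
    (hmean : ∀ r ∈ T, ∀ i, ∑ y ∈ O, v r i y = 0) {R : ℝ} (hR : 0 < R)
    (hcard : Fintype.card ι ≤ R ^ 2) :
    ∃ x : ι → Ω, (∀ i, x i ∈ O) ∧
      ∀ r ∈ T, ∑ i, v r i (x i) ≤ R * (Real.log #T + 1 / 2) := by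
  obtain ⟨x, hx, hsum⟩ := exists_choice_sum_exp_le hO T hv hmean R⁻¹
  refine ⟨x, hx, fun r hr => ?_⟩
  have hT : (0 : ℝ) < #T := by exact_mod_cast card_pos.2 ⟨r, hr⟩
  have hexp : Real.exp (R⁻¹ * ∑ i, v r i (x i)) ≤ #T * Real.exp (1 / 2) :=
    calc Real.exp (R⁻¹ * ∑ i, v r i (x i))
        ≤ ∑ r ∈ T, Real.exp (R⁻¹ * ∑ i, v r i (x i)) :=
          single_le_sum (f := fun r => Real.exp (R⁻¹ * ∑ i, v r i (x i)))
            (fun _ _ => (Real.exp_pos _).le) hr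
      _ ≤ #T * Real.exp (Fintype.card ι * (R⁻¹ ^ 2 / 2)) := by rwa [Real.exp_nat_mul]
      _ ≤ #T * Real.exp (1 / 2) := by
          gcongr
          rw [inv_pow, ← mul_div_assoc, ← div_eq_mul_inv]
          gcongr
          exact div_le_one_of_le₀ hcard (by positivity)
  have hlog := (Real.le_log_iff_exp_le (by positivity)).2 hexp
  rwa [Real.log_mul hT.ne' (Real.exp_ne_zero _), Real.log_exp, inv_mul_le_iff₀ hR] at hlog

theorem exists_choice_norm_sum_le {O : Finset Ω} (hO : O.Nonempty) (T : Finset τ)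
    {u : τ → ι → Ω → ℂ} (hu : ∀ r ∈ T, ∀ i, ∀ y ∈ O, ‖u r i y‖ ≤ 1)
    (hmean : ∀ r ∈ T, ∀ i, ∑ y ∈ O, u r i y = 0) {R : ℝ} (hR : 0 < R)
    (hcard : Fintype.card ι ≤ R ^ 2) :
    ∃ x : ι → Ω, (∀ i, x i ∈ O) ∧
      ∀ r ∈ T, ‖∑ i, u r i (x i)‖ ≤ R * (2 * Real.log (4 * #T) + 1) := by
  -- Control the real parts of `I ^ e * u` for `e = 0, 1, 2, 3`.
  obtain ⟨x, hx, hsum⟩ := exists_choice_sum_le hO (T ×ˢ (univ : Finset (Fin 4)))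
    (v := fun r i y => (Complex.I ^ (r.2 : ℕ) * u r.1 i y).re)
    (fun r hr i y hy => (Complex.abs_re_le_norm _).trans
      (by simpa using hu r.1 (mem_product.1 hr).1 i y hy))
    (fun r hr i => by
      rw [← Complex.re_sum, ← mul_sum, hmean r.1 (mem_product.1 hr).1, mul_zero, Complex.zero_re])
    hR hcard
  refine ⟨x, hx, fun r hr => ?_⟩
  have hdir : ∀ e : Fin 4, (Complex.I ^ (e : ℕ) * ∑ i, u r i (x i)).re ≤
      R * (Real.log (4 * #T) + 1 / 2) := fun e => by
    have h := hsum (r, e) (mk_mem_product hr (mem_univ e))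
    rw [← Complex.re_sum, ← mul_sum, card_product, card_univ, Fintype.card_fin, mul_comm #T] at h
    exact_mod_cast h
  have h0 := hdir 0
  have h1 := hdir 1
  have h2 := hdir 2
  have h3 := hdir 3
  simp only [Fin.coe_ofNat_eq_mod, pow_zero, pow_one,
    one_mul, Complex.I_sq, neg_mul, Complex.neg_re, Complex.I_mul_re, Nat.reduceMod,
    Complex.I_pow_three, neg_neg] at h0 h1 h2 h3
  calc ‖∑ i, u r i (x i)‖ ≤ |(∑ i, u r i (x i)).re| + |(∑ i, u r i (x i)).im| :=
        Complex.norm_le_abs_re_add_abs_im _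
    _ ≤ R * (Real.log (4 * #T) + 1 / 2) + R * (Real.log (4 * #T) + 1 / 2) :=
        add_le_add (abs_le'.2 ⟨h0, h2⟩) (abs_le'.2 ⟨h3, h1⟩)
    _ = R * (2 * Real.log (4 * #T) + 1) := by ring

end RandomChoice

section Discrepancy

variable {ι τ : Type*} {N t : ℕ} {B : Finset ℕ}

/-- The difference between the average of `f` over a set `B` of digits and its average over all
digits `0, …, N - 1`. -/
noncomputable def discrepancy (N : ℕ) (f : ℕ → ℂ) (B : Finset ℕ) : ℂ :=
  𝔼 b ∈ B, f b - 𝔼 b ∈ range N, f b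

theorem norm_expect_sub_le {s : Finset ι} (hs : s.Nonempty) {f : ι → ℂ} {z : ℂ} {ε : ℝ}
    (hf : ∀ i ∈ s, ‖f i - z‖ ≤ ε) : ‖𝔼 i ∈ s, f i - z‖ ≤ ε :=
  calc ‖𝔼 i ∈ s, f i - z‖ = ‖𝔼 i ∈ s, (f i - z)‖ := by rw [expect_sub_distrib, expect_const hs]
    _ ≤ 𝔼 i ∈ s, ‖f i - z‖ := RCLike.norm_expect_le (K := ℂ)
    _ ≤ ε := expect_le hs hf

theorem norm_discrepancy_le (hB : B ⊆ range N) (hB₀ : B.Nonempty) {f : ℕ → ℂ} {z : ℂ} {ε : ℝ}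
    (hf : ∀ b ∈ range N, ‖f b - z‖ ≤ ε) : ‖discrepancy N f B‖ ≤ 2 * ε :=
  calc ‖discrepancy N f B‖ = ‖(𝔼 b ∈ B, f b - z) - (𝔼 b ∈ range N, f b - z)‖ := by
        rw [discrepancy, sub_sub_sub_cancel_right]
    _ ≤ ‖𝔼 b ∈ B, f b - z‖ + ‖𝔼 b ∈ range N, f b - z‖ := norm_sub_le _ _
    _ ≤ ε + ε := add_le_add (norm_expect_sub_le hB₀ fun b hb => hf b (hB hb))
        (norm_expect_sub_le (hB₀.mono hB) hf)
    _ = 2 * ε := (two_mul ε).symm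

theorem norm_discrepancy_le_two (hB : B ⊆ range N) (hB₀ : B.Nonempty) {f : ℕ → ℂ}
    (hf : ∀ b, ‖f b‖ ≤ 1) : ‖discrepancy N f B‖ ≤ 2 :=
  (norm_discrepancy_le hB hB₀ (z := 0) fun b _ => by rw [sub_zero]; exact hf b).trans_eq
    (mul_one 2)

/-- The translate of `{0, …, t - 1}` by `x` modulo `N`. -/
def cyclicInterval (N t x : ℕ) : Finset ℕ := (Ico x (x + t)).image (· % N)

theorem cyclicInterval_subset (hN : 0 < N) (t x : ℕ) : cyclicInterval N t x ⊆ range N :=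
  image_subset_iff.2 fun _ _ => mem_range.2 (Nat.mod_lt _ hN)

theorem mod_injOn_Ico_of_le (htN : t ≤ N) (x : ℕ) :
    Set.InjOn (· % N) (Ico x (x + t) : Set ℕ) :=
  (Nat.mod_injOn_Ico x N).mono (by exact_mod_cast Ico_subset_Ico_right (by omega))

theorem card_cyclicInterval (htN : t ≤ N) (x : ℕ) : #(cyclicInterval N t x) = t := by
  rw [cyclicInterval, card_image_of_injOn (mod_injOn_Ico_of_le htN x), Nat.card_Ico,
    Nat.add_sub_cancel_left]

theorem sum_range_add_mod {A : Type*} [AddCommMonoid A] (f : ℕ → A) (N i : ℕ) :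
    ∑ x ∈ range N, f ((i + x) % N) = ∑ x ∈ range N, f x := by
  have hIco := sum_image (f := f) (Nat.mod_injOn_Ico i N)
  rw [Nat.image_Ico_mod] at hIco
  rw [hIco, sum_Ico_eq_sum_range, Nat.add_sub_cancel_left]

theorem sum_discrepancy_cyclicInterval (ht : 0 < t) (htN : t ≤ N) (f : ℕ → ℂ) :
    ∑ x ∈ range N, discrepancy N f (cyclicInterval N t x) = 0 := by
  have ht₀ : (t : ℂ) ≠ 0 := by exact_mod_cast ht.ne'
  have hN₀ : (N : ℂ) ≠ 0 := by exact_mod_cast (ht.trans_le htN).ne'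
  have hcyclic : ∑ x ∈ range N, 𝔼 b ∈ cyclicInterval N t x, f b = ∑ b ∈ range N, f b :=
    calc ∑ x ∈ range N, 𝔼 b ∈ cyclicInterval N t x, f b
        = ∑ x ∈ range N, (∑ i ∈ range t, f ((i + x) % N)) / t := by
          refine sum_congr rfl fun x _ => ?_
          rw [expect_eq_sum_div_card, card_cyclicInterval htN, cyclicInterval,
            sum_image (mod_injOn_Ico_of_le htN x), sum_Ico_eq_sum_range, Nat.add_sub_cancel_left]
          simp only [add_comm]
      _ = (∑ _i ∈ range t, ∑ x ∈ range N, f x) / t := by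
          rw [← sum_div, sum_comm]
          simp only [sum_range_add_mod]
      _ = ∑ b ∈ range N, f b := by
          rw [sum_const, card_range, nsmul_eq_mul, mul_div_cancel_left₀ _ ht₀]
  simp only [discrepancy, sum_sub_distrib, hcyclic]
  rw [sum_const, card_range, nsmul_eq_mul, expect_eq_sum_div_card, card_range,
    mul_div_cancel₀ _ hN₀, sub_self]

theorem exists_cyclicInterval_norm_sum_le (ht : 0 < t) (htN : t ≤ N) (s : Finset ι) {R : ℝ}
    (hR : 0 < R) (hs : #s ≤ R ^ 2) (T : Finset τ) {f : τ → ι → ℕ → ℂ}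
    (hf : ∀ r i b, ‖f r i b‖ ≤ 1) :
    ∃ x : ι → ℕ, ∀ r ∈ T, ‖∑ i ∈ s, discrepancy N (f r i) (cyclicInterval N t (x i))‖ ≤
      R * (4 * Real.log (4 * #T) + 2) := by
  classical
  have hN : 0 < N := ht.trans_le htN
  have hne : ∀ x, (cyclicInterval N t x).Nonempty := fun x =>
    card_pos.1 (by rwa [card_cyclicInterval htN])
  obtain ⟨x, -, hx⟩ := exists_choice_norm_sum_le (ι := s) (nonempty_range_iff.2 hN.ne') T
    (u := fun r i x => discrepancy N (f r i) (cyclicInterval N t x) / 2)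
    (fun r _ i x _ => by
      rw [norm_div, Complex.norm_ofNat, div_le_one two_pos]
      exact norm_discrepancy_le_two (cyclicInterval_subset hN t x) (hne x) (hf r i))
    (fun r _ i => by rw [← sum_div, sum_discrepancy_cyclicInterval ht htN, zero_div])
    hR (by rwa [Fintype.card_coe])
  refine ⟨fun i => if h : i ∈ s then x ⟨i, h⟩ else 0, fun r hr => ?_⟩
  have h := hx r hr
  rw [← sum_div, norm_div, Complex.norm_ofNat, div_le_iff₀ two_pos] at h
  rw [← sum_coe_sort s]
  simp only [coe_mem, dite_true, Subtype.coe_eta]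
  linarith

theorem exists_digits_norm_sum_discrepancy_le (ht : 0 < t) (htN : t ≤ N) {P : Finset ℕ}
    (hPN : P ⊆ range N) (hPt : #P ≤ t) (s Q : Finset ι) {R : ℝ} (hR : 0 < R) (hs : #s ≤ R ^ 2)
    (hQ : #Q ≤ R) (T : Finset τ) {f : τ → ι → ℕ → ℂ} (hf : ∀ r i b, ‖f r i b‖ ≤ 1) :
    ∃ B : ι → Finset ℕ, (∀ i, B i ⊆ range N) ∧ (∀ i, #(B i) = t) ∧ (∀ i ∈ Q, P ⊆ B i) ∧
      ∀ r ∈ T, ‖∑ i ∈ s, discrepancy N (f r i) (B i)‖ ≤ 4 * R * (Real.log (4 * #T) + 1) := by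
  classical
  obtain ⟨B₀, hPB₀, hB₀N, hB₀t⟩ := exists_subsuperset_card_eq hPN hPt (by rwa [card_range])
  obtain ⟨x, hx⟩ := exists_cyclicInterval_norm_sum_le ht htN (s \ Q) hR
    (le_trans (by exact_mod_cast card_le_card sdiff_subset) hs) T hf
  refine ⟨fun i => if i ∈ Q then B₀ else cyclicInterval N t (x i), fun i => ?_, fun i => ?_,
    fun i hi => by simpa only [hi, if_true], fun r hr => ?_⟩
  · dsimp only
    split_ifs
    exacts [hB₀N, cyclicInterval_subset (ht.trans_le htN) _ _]
  · dsimp only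
    split_ifs
    exacts [hB₀t, card_cyclicInterval htN _]
  have hstructured : ‖∑ i ∈ s ∩ Q, discrepancy N (f r i) B₀‖ ≤ R * 2 :=
    calc ‖∑ i ∈ s ∩ Q, discrepancy N (f r i) B₀‖ ≤ #(s ∩ Q) • (2 : ℝ) :=
          (norm_sum_le_of_le _ fun i _ => norm_discrepancy_le_two hB₀N
            (card_pos.1 (hB₀t ▸ ht)) (hf r i)).trans_eq (sum_const _)
      _ ≤ R * 2 := by
          rw [nsmul_eq_mul]
          gcongr
          exact le_trans (by exact_mod_cast card_le_card inter_subset_right) hQ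
  have hsplit : ∑ i ∈ s, discrepancy N (f r i) (if i ∈ Q then B₀ else cyclicInterval N t (x i)) =
      ∑ i ∈ s ∩ Q, discrepancy N (f r i) B₀ +
        ∑ i ∈ s \ Q, discrepancy N (f r i) (cyclicInterval N t (x i)) := by
    rw [← sum_inter_add_sum_sdiff s Q]
    congr 1
    · exact sum_congr rfl fun i hi => by rw [if_pos (mem_inter.1 hi).2]
    · exact sum_congr rfl fun i hi => by rw [if_neg (mem_sdiff.1 hi).2]
  rw [hsplit]
  linarith [norm_add_le_of_le hstructured (hx r hr)]

end Discrepancy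

section Wave

/-- The character `x ↦ e^{-2πiξx}`. -/
noncomputable def wave (ξ x : ℝ) : ℂ := Complex.exp (-2 * Real.pi * Complex.I * ξ * x)

theorem wave_eq_exp_mul_I (ξ x : ℝ) :
    wave ξ x = Complex.exp ((-2 * Real.pi * ξ * x : ℝ) * Complex.I) := by
  rw [wave]
  push_cast
  ring_nf

@[simp]
theorem norm_wave (ξ x : ℝ) : ‖wave ξ x‖ = 1 := by
  rw [wave_eq_exp_mul_I, Complex.norm_exp_ofReal_mul_I]

theorem wave_add (ξ x y : ℝ) : wave ξ (x + y) = wave ξ x * wave ξ y := by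
  rw [wave, wave, wave, ← Complex.exp_add, Complex.ofReal_add, mul_add]

theorem norm_wave_sub_one_le (ξ x : ℝ) : ‖wave ξ x - 1‖ ≤ 2 * Real.pi * |ξ| * |x| :=
  calc ‖wave ξ x - 1‖ = ‖Complex.exp (Complex.I * (-2 * Real.pi * ξ * x : ℝ)) - 1‖ := by
        rw [wave_eq_exp_mul_I, mul_comm]
    _ ≤ ‖-2 * Real.pi * ξ * x‖ := Real.norm_exp_I_mul_ofReal_sub_one_le
    _ = 2 * Real.pi * |ξ| * |x| := by
        simp only [norm_mul, norm_neg, Real.norm_ofNat, Real.norm_eq_abs, abs_of_pos Real.pi_pos]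

theorem continuous_wave (ξ : ℝ) : Continuous (wave ξ) := by
  unfold wave
  fun_prop

theorem exists_wave_natCast_div_eq {q : ℕ} (hq : 0 < q) (k : ℤ) :
    ∃ r ∈ range q, ∀ n : ℕ, wave k (n / q) = wave (r : ℕ) (n / q) := by
  have hq₀ : (q : ℂ) ≠ 0 := by exact_mod_cast hq.ne'
  lift k % q to ℕ using Int.emod_nonneg k (by exact_mod_cast hq.ne') with r hr
  have hrq : (r : ℤ) < q := hr ▸ Int.emod_lt_of_pos k (by exact_mod_cast hq)
  refine ⟨r, mem_range.2 (by exact_mod_cast hrq), fun n => ?_⟩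
  have hk : (k : ℂ) = r + q * (k / q : ℤ) := by
    exact_mod_cast (hr ▸ Int.emod_add_mul_ediv k q).symm
  rw [wave, wave, Complex.exp_eq_exp_iff_exists_int]
  refine ⟨-(k / q) * n, ?_⟩
  push_cast
  rw [hk]
  field_simp
  ring

end Wave

section Tree

variable {N t : ℕ}

/-- The children `N * m + i`, `i ∈ b m`, of the vertices `m ∈ s`; they are the base `N` numbers
obtained from those in `s` by appending a digit allowed by `b`. -/
def children (N : ℕ) (b : ℕ → Finset ℕ) (s : Finset ℕ) : Finset ℕ :=
  s.biUnion fun m => (b m).image (N * m + ·)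

theorem mem_children {b : ℕ → Finset ℕ} {s : Finset ℕ} {n : ℕ} :
    n ∈ children N b s ↔ ∃ m ∈ s, ∃ i ∈ b m, N * m + i = n := by
  simp only [children, mem_biUnion, mem_image]

theorem mul_add_div_of_lt {m i : ℕ} (hi : i < N) : (N * m + i) / N = m := by
  rw [Nat.mul_add_div (by lia), Nat.div_eq_of_lt hi, add_zero]

theorem sum_children {A : Type*} [AddCommMonoid A] {b : ℕ → Finset ℕ}
    (hb : ∀ m, b m ⊆ range N) (s : Finset ℕ) (f : ℕ → A) :
    ∑ n ∈ children N b s, f n = ∑ m ∈ s, ∑ i ∈ b m, f (N * m + i) := by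
  rw [children, sum_biUnion]
  · exact sum_congr rfl fun m _ => sum_image fun i _ i' _ h => Nat.add_left_cancel h
  · refine fun m _ m' _ hne => disjoint_left.2 fun n hn hn' => hne ?_
    obtain ⟨i, hi, rfl⟩ := mem_image.1 hn
    obtain ⟨i', hi', h⟩ := mem_image.1 hn'
    rw [← mul_add_div_of_lt (m := m) (mem_range.1 (hb m hi)), ← h,
      mul_add_div_of_lt (mem_range.1 (hb m' hi'))]

theorem card_children {b : ℕ → Finset ℕ} (hb : ∀ m, b m ⊆ range N) (hbt : ∀ m, #(b m) = t)
    (s : Finset ℕ) : #(children N b s) = #s * t := by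
  rw [card_eq_sum_ones, sum_children hb]
  simp only [sum_const, smul_eq_mul, mul_one, hbt]

/-- The tree of base `N` numbers in which the vertex `m` of level `j` has the children
`N * m + i` with `i ∈ B j m`. A vertex `m` of level `j` encodes the left endpoint `m / N ^ j`. -/
def digitTree (N : ℕ) (B : ℕ → ℕ → Finset ℕ) : ℕ → Finset ℕ
  | 0 => {0}
  | j + 1 => children N (B j) (digitTree N B j)

theorem card_digitTree {B : ℕ → ℕ → Finset ℕ} (hB : ∀ j m, B j m ⊆ range N)
    (hBt : ∀ j m, #(B j m) = t) (j : ℕ) : #(digitTree N B j) = t ^ j := by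
  induction j with
  | zero => rw [digitTree, card_singleton, pow_zero]
  | succ j ih => rw [digitTree, card_children (hB j) (hBt j), ih, pow_succ]

theorem digitTree_mono {B B' : ℕ → ℕ → Finset ℕ}
    (h : ∀ j, ∀ m ∈ digitTree N B j, B j m ⊆ B' j m) (j : ℕ) :
    digitTree N B j ⊆ digitTree N B' j := by
  induction j with
  | zero => exact Subset.rfl
  | succ j ih =>
    intro n hn
    obtain ⟨m, hm, i, hi, rfl⟩ := mem_children.1 hn
    exact mem_children.2 ⟨m, ih hm, i, h j m hm hi, rfl⟩

theorem exists_digitTree_forall {p : ℕ → Finset ℕ → (ℕ → Finset ℕ) → Prop}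
    {q : ℕ → Finset ℕ → Prop} (hzero : q 0 {0})
    (hstep : ∀ j s, q j s → ∃ b, p j s b ∧ q (j + 1) (children N b s)) :
    ∃ B, ∀ j, p j (digitTree N B j) (B j) := by
  choose b hp hq using hstep
  let T : ∀ j, {s // q j s} := fun j =>
    Nat.rec ⟨{0}, hzero⟩ (fun j s => ⟨children N (b j s s.2) s, hq j s s.2⟩) j
  let B : ℕ → ℕ → Finset ℕ := fun j => b j (T j).1 (T j).2
  have hT : ∀ j, digitTree N B j = (T j).1 := fun j => by
    induction j with
    | zero => rfl
    | succ j ih => rw [digitTree, ih]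
  exact ⟨B, fun j => hT j ▸ hp j (T j).1 (T j).2⟩

/-- The vertices of level `j` of the tree whose ancestor at level `l ≤ j` belongs to `A`. -/
def descendants (N : ℕ) (B : ℕ → ℕ → Finset ℕ) (A : Finset ℕ) (l j : ℕ) : Finset ℕ :=
  {m ∈ digitTree N B j | m / N ^ (j - l) ∈ A}

theorem descendants_zero {B : ℕ → ℕ → Finset ℕ} (hB : ∀ j m, B j m ⊆ range N) (j : ℕ) :
    descendants N B {0} 0 j = digitTree N B j := by
  have hlt : ∀ m ∈ digitTree N B j, m < N ^ j := by
    induction j with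
    | zero => simp [digitTree]
    | succ j ih =>
      intro n hn
      obtain ⟨m, hm, i, hi, rfl⟩ := mem_children.1 hn
      calc N * m + i < N * (m + 1) := by have := mem_range.1 (hB j m hi); lia
        _ ≤ N * N ^ j := Nat.mul_le_mul_left _ (ih m hm)
        _ = N ^ (j + 1) := (pow_succ' _ _).symm
  exact filter_true_of_mem fun m hm => mem_singleton.2 (Nat.div_eq_of_lt (hlt m hm))

theorem descendants_succ {B : ℕ → ℕ → Finset ℕ} (hB : ∀ j m, B j m ⊆ range N) (A : Finset ℕ)
    {l j : ℕ} (hl : l ≤ j) :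
    descendants N B A l (j + 1) = children N (B j) (descendants N B A l j) := by
  have hancestor : ∀ m, ∀ i ∈ B j m, (N * m + i) / N ^ (j + 1 - l) = m / N ^ (j - l) :=
    fun m i hi => by
      rw [Nat.succ_sub hl, pow_succ', ← Nat.div_div_eq_div_mul,
        mul_add_div_of_lt (mem_range.1 (hB j m hi))]
  ext n
  simp only [descendants, digitTree, mem_filter, mem_children]
  constructor
  · rintro ⟨⟨m, hm, i, hi, rfl⟩, hA⟩
    exact ⟨m, ⟨hm, hancestor m i hi ▸ hA⟩, i, hi, rfl⟩
  · rintro ⟨m, ⟨hm, hA⟩, i, hi, rfl⟩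
    exact ⟨⟨m, hm, i, hi, rfl⟩, (hancestor m i hi).symm ▸ hA⟩

theorem card_descendants_le {B : ℕ → ℕ → Finset ℕ} (hB : ∀ j m, B j m ⊆ range N)
    (hBt : ∀ j m, #(B j m) = t) (A : Finset ℕ) (l j : ℕ) : #(descendants N B A l j) ≤ t ^ j :=
  (card_filter_le _ _).trans_eq (card_digitTree hB hBt j)

/-- The sum over the vertices `m ∈ s` of level `j` of the discrepancy of the digit set `b m`
measured by the character of frequency `ξ` at the left endpoints of the children of `m`. -/
noncomputable def childDiscrepancy (N : ℕ) (b : ℕ → Finset ℕ) (s : Finset ℕ) (j : ℕ) (ξ : ℝ) : ℂ :=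
  ∑ m ∈ s, discrepancy N (fun i => wave ξ ((N * m + i : ℕ) / (N : ℝ) ^ (j + 1))) (b m)

theorem log_four_mul_succ_mul_pow_add_one_le (hN : 0 < N) (j : ℕ) :
    Real.log (4 * ((j + 1) * N ^ (j + 1))) + 1 ≤ (3 + Real.log N) * (j + 1) := by
  have hlogj := Real.log_le_sub_one_of_pos (show (0 : ℝ) < j + 1 by positivity)
  have hlog4 : Real.log 4 ≤ 2 := by
    rw [show (4 : ℝ) = 2 ^ 2 by norm_num, Real.log_pow]
    push_cast
    linarith [Real.log_two_lt_d9]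
  rw [Real.log_mul (by norm_num) (by positivity), Real.log_mul (by positivity) (by positivity),
    Real.log_pow]
  push_cast
  linarith [j.cast_nonneg (α := ℝ)]

theorem exists_digits_norm_childDiscrepancy_le (ht : 0 < t) (htN : t ≤ N) {P : Finset ℕ}
    (hPN : P ⊆ range N) (hPt : #P ≤ t) (j : ℕ) {s Q : Finset ℕ} (hs : #s ≤ t ^ j)
    (hQ : #Q ≤ √(t : ℝ) ^ j) {u : ℕ → Finset ℕ} (hu : ∀ l, u l ⊆ s) :
    ∃ b : ℕ → Finset ℕ, (∀ m, b m ⊆ range N) ∧ (∀ m, #(b m) = t) ∧ (∀ m ∈ Q, P ⊆ b m) ∧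
      ∀ l ≤ j, ∀ k : ℤ, ‖childDiscrepancy N b (u l) j k‖ ≤
        (12 + 4 * Real.log N) * ((j + 1) * √(t : ℝ) ^ j) := by
  have hN : 0 < N := ht.trans_le htN
  have ht₀ : (0 : ℝ) < t := by exact_mod_cast ht
  have hsR : (#s : ℝ) ≤ (√(t : ℝ) ^ j) ^ 2 := by
    rw [← pow_mul, mul_comm, pow_mul, Real.sq_sqrt ht₀.le]
    exact_mod_cast hs
  let f : ℕ × ℕ → ℕ → ℕ → ℂ := fun r m i =>
    if m ∈ u r.1 then wave r.2 ((N * m + i : ℕ) / (N : ℝ) ^ (j + 1)) else 0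
  have hf : ∀ r m i, ‖f r m i‖ ≤ 1 := fun r m i => by
    dsimp only [f]
    split_ifs <;> simp
  obtain ⟨b, hbN, hbt, hbP, hb⟩ := exists_digits_norm_sum_discrepancy_le ht htN hPN hPt s Q
    (by positivity) hsR hQ (range (j + 1) ×ˢ range (N ^ (j + 1))) hf
  refine ⟨b, hbN, hbt, hbP, fun l hl k => ?_⟩
  obtain ⟨r, hr, hkr⟩ := exists_wave_natCast_div_eq (pow_pos hN (j + 1)) k
  have hsum : ∑ m ∈ s, discrepancy N (f (l, r) m) (b m) = childDiscrepancy N b (u l) j k := by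
    rw [childDiscrepancy, ← sum_subset (hu l) fun m _ hm => by simp [f, hm, discrepancy]]
    refine sum_congr rfl fun m hm => ?_
    congr 1
    funext i
    rw [← Nat.cast_pow, hkr]
    simp only [f, hm, if_true, Nat.cast_pow]
  have hlr := hb (l, r) (mk_mem_product (mem_range.2 (Nat.lt_succ_of_le hl)) hr)
  rw [hsum, card_product, card_range, card_range, Nat.cast_mul, Nat.cast_pow, Nat.cast_succ] at hlr
  calc ‖childDiscrepancy N b (u l) j k‖
      ≤ 4 * √(t : ℝ) ^ j * (Real.log (4 * ((j + 1) * N ^ (j + 1))) + 1) := hlr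
    _ ≤ 4 * √(t : ℝ) ^ j * ((3 + Real.log N) * (j + 1)) := by
        gcongr
        exact log_four_mul_succ_mul_pow_add_one_le hN j
    _ = (12 + 4 * Real.log N) * ((j + 1) * √(t : ℝ) ^ j) := by ring

theorem exists_digitTree_norm_childDiscrepancy_le (ht : 0 < t) (htN : t ≤ N) {P : Finset ℕ}
    (hPN : P ⊆ range N) (hPt : #P ≤ t) {A : ℕ → Finset ℕ} (hA : ∀ j, #(A j) ≤ √(t : ℝ) ^ j) :
    ∃ B : ℕ → ℕ → Finset ℕ, (∀ j m, B j m ⊆ range N) ∧ (∀ j m, #(B j m) = t) ∧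
      (∀ j, ∀ m ∈ A j, P ⊆ B j m) ∧
      ∀ l j, l ≤ j → ∀ k : ℤ, ‖childDiscrepancy N (B j) (descendants N B (A l) l j) j k‖ ≤
        (12 + 4 * Real.log N) * ((j + 1) * √(t : ℝ) ^ j) := by
  obtain ⟨B, hB⟩ := exists_digitTree_forall (N := N)
    (p := fun j s b => (∀ m, b m ⊆ range N) ∧ (∀ m, #(b m) = t) ∧ (∀ m ∈ A j, P ⊆ b m) ∧
      ∀ l ≤ j, ∀ k : ℤ, ‖childDiscrepancy N b {m ∈ s | m / N ^ (j - l) ∈ A l} j k‖ ≤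
        (12 + 4 * Real.log N) * ((j + 1) * √(t : ℝ) ^ j))
    (q := fun j s => #s = t ^ j) (by rw [card_singleton, pow_zero]) fun j s hs => by
      obtain ⟨b, hbN, hbt, hb⟩ := exists_digits_norm_childDiscrepancy_le ht htN hPN hPt j hs.le
        (hA j) (fun l => filter_subset (fun m => m / N ^ (j - l) ∈ A l) s)
      exact ⟨b, ⟨hbN, hbt, hb⟩, by rw [card_children hbN hbt, hs, pow_succ]⟩
  exact ⟨B, fun j => (hB j).1, fun j => (hB j).2.1, fun j => (hB j).2.2.1,
    fun l j hl => (hB j).2.2.2 l hl⟩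

end Tree

section Geometry

variable {N t : ℕ} {B : ℕ → ℕ → Finset ℕ}

/-- The choice of the sets `A_{j+1,a}` that corresponds to the digit sets `B`: an endpoint
`a = m / N ^ j` gets the set `N ^ (-(j + 1)) * B j m`. -/
noncomputable def digitChoice (N : ℕ) (B : ℕ → ℕ → Finset ℕ) : ℕ → ℝ → Finset ℝ
  | 0, _ => ∅
  | j + 1, a => (B j ⌊a * (N : ℝ) ^ j⌋₊).image fun i : ℕ => (i : ℝ) / (N : ℝ) ^ (j + 1)

theorem digitChoice_succ (hN : 0 < N) (j m : ℕ) : digitChoice N B (j + 1) (m / (N : ℝ) ^ j) =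
    (B j m).image fun i : ℕ => (i : ℝ) / (N : ℝ) ^ (j + 1) := by
  rw [digitChoice, div_mul_cancel₀ _ (by positivity), Nat.floor_natCast]

theorem natCast_mul_add_div_pow_succ (hN : 0 < N) (j m i : ℕ) :
    ((N * m + i : ℕ) : ℝ) / (N : ℝ) ^ (j + 1) = m / (N : ℝ) ^ j + i / (N : ℝ) ^ (j + 1) := by
  rw [Nat.cast_add, Nat.cast_mul, add_div, pow_succ', mul_div_mul_left _ _ (by positivity)]

theorem image_div_pow_children (hN : 0 < N) (b : ℕ → Finset ℕ) (s : Finset ℕ) (j : ℕ) :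
    (children N b s).image (fun n : ℕ => (n : ℝ) / (N : ℝ) ^ (j + 1)) =
      s.biUnion fun m => (b m).image fun i : ℕ => m / (N : ℝ) ^ j + i / (N : ℝ) ^ (j + 1) := by
  simp only [children, biUnion_image, image_image, Function.comp_def,
    natCast_mul_add_div_pow_succ hN]

theorem endpoints_digitChoice (hN : 0 < N) (j : ℕ) : endpoints (digitChoice N B) j =
    (digitTree N B j).image fun m : ℕ => (m : ℝ) / (N : ℝ) ^ j := by
  induction j with
  | zero => simp only [endpoints, digitTree, image_singleton, Nat.cast_zero, zero_div]
  | succ j ih =>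
    simp only [endpoints, digitTree, ih, image_biUnion, digitChoice_succ hN, image_image,
      Function.comp_def, image_div_pow_children hN]

theorem structured_eq_image_digitTree (hN : 0 < N) (P : Finset ℕ) (j : ℕ) : structured N P j =
    (digitTree N (fun _ _ => P) j).image fun m : ℕ => (m : ℝ) / (N : ℝ) ^ j := by
  induction j with
  | zero => simp only [structured, digitTree, image_singleton, Nat.cast_zero, zero_div]
  | succ j ih => simp only [structured, digitTree, ih, image_biUnion, image_div_pow_children hN]

theorem div_pow_injective (hN : 0 < N) (j : ℕ) :
    Function.Injective fun m : ℕ => (m : ℝ) / (N : ℝ) ^ j :=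
  fun _ _ h => Nat.cast_injective ((div_left_inj' (by positivity)).1 h)

theorem card_endpoints_digitChoice (hN : 0 < N) (hB : ∀ j m, B j m ⊆ range N)
    (hBt : ∀ j m, #(B j m) = t) (j : ℕ) : #(endpoints (digitChoice N B) j) = t ^ j := by
  rw [endpoints_digitChoice hN, card_image_of_injective _ (div_pow_injective hN j),
    card_digitTree hB hBt]

theorem isAdmissible_digitChoice (hN : 0 < N) (hB : ∀ j m, B j m ⊆ range N)
    (hBt : ∀ j m, #(B j m) = t) : IsAdmissible N t (digitChoice N B) := by
  intro j a ha
  rw [endpoints_digitChoice hN] at ha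
  obtain ⟨m, -, rfl⟩ := mem_image.1 ha
  rw [digitChoice_succ hN]
  exact ⟨image_subset_image (hB j m),
    by rw [card_image_of_injective _ (div_pow_injective hN _), hBt]⟩

theorem structured_subset_endpoints (hN : 0 < N) {P : Finset ℕ}
    (hP : ∀ j, ∀ m ∈ digitTree N (fun _ _ => P) j, P ⊆ B j m) (j : ℕ) :
    structured N P j ⊆ endpoints (digitChoice N B) j := by
  rw [structured_eq_image_digitTree hN, endpoints_digitChoice hN]
  exact image_subset_image (digitTree_mono hP j)

theorem structuredLevel_subset_level {P : Finset ℕ} {D : ℕ → ℝ → Finset ℝ} {j : ℕ}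
    (h : structured N P j ⊆ endpoints D j) : structuredLevel N P j ⊆ level N D j :=
  Set.biUnion_mono h fun _ _ => Set.Ico_subset_Icc_self

theorem antitone_level_digitChoice (hN : 0 < N) (hB : ∀ j m, B j m ⊆ range N) :
    Antitone (level N (digitChoice N B)) := by
  refine antitone_nat_of_succ_le fun j x hx => ?_
  simp only [level, endpoints_digitChoice hN, Set.mem_iUnion, mem_image, exists_prop,
    exists_exists_and_eq_and] at hx ⊢
  obtain ⟨n, hn, hnx, hxn⟩ := hx
  obtain ⟨m, hm, i, hi, rfl⟩ := mem_children.1 hn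
  rw [natCast_mul_add_div_pow_succ hN] at hnx hxn
  have hi₀ : (0 : ℝ) ≤ i / (N : ℝ) ^ (j + 1) := by positivity
  have hiN : i / (N : ℝ) ^ (j + 1) + 1 / (N : ℝ) ^ (j + 1) ≤ 1 / (N : ℝ) ^ j := by
    rw [← add_div, div_le_div_iff₀ (by positivity) (by positivity), one_mul, pow_succ']
    gcongr
    exact_mod_cast mem_range.1 (hB j m hi)
  exact ⟨m, hm, by linarith, by linarith⟩

theorem isCompact_level (N : ℕ) (D : ℕ → ℝ → Finset ℝ) (j : ℕ) : IsCompact (level N D j) :=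
  (endpoints D j).isCompact_biUnion fun _ _ => isCompact_Icc

theorem mem_Ico_div_pow_iff (hN : 0 < N) {x : ℝ} (hx : 0 ≤ x) (j m : ℕ) :
    x ∈ Set.Ico (m / (N : ℝ) ^ j) (m / (N : ℝ) ^ j + 1 / (N : ℝ) ^ j) ↔
      ⌊x * (N : ℝ) ^ j⌋₊ = m := by
  rw [Nat.floor_eq_iff (by positivity), Set.mem_Ico, ← add_div, div_le_iff₀ (by positivity),
    lt_div_iff₀ (by positivity)]

theorem mem_structuredLevel_iff (hN : 0 < N) (P : Finset ℕ) {l j m : ℕ} (hl : l ≤ j) {x : ℝ}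
    (hx : x ∈ Set.Ico (m / (N : ℝ) ^ j) (m / (N : ℝ) ^ j + 1 / (N : ℝ) ^ j)) :
    x ∈ structuredLevel N P l ↔ m / N ^ (j - l) ∈ digitTree N (fun _ _ => P) l := by
  have hx₀ : 0 ≤ x := le_trans (by positivity) hx.1
  have hancestor : ⌊x * (N : ℝ) ^ l⌋₊ = m / N ^ (j - l) := by
    rw [← (mem_Ico_div_pow_iff hN hx₀ j m).1 hx, ← Nat.floor_div_natCast, Nat.cast_pow,
      ← Nat.sub_add_cancel hl, pow_add, Nat.add_sub_cancel, mul_div_assoc,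
      mul_div_cancel_left₀ _ (by positivity)]
  simp only [structuredLevel, structured_eq_image_digitTree hN, Set.mem_iUnion, mem_image,
    exists_prop, exists_exists_and_eq_and, mem_Ico_div_pow_iff hN hx₀, hancestor,
    exists_eq_right']

end Geometry

section CellMean

variable {N : ℕ} {ξ : ℝ}

/-- The mean of the character `wave ξ` over `[0, N ^ (-j)]`. -/
noncomputable def cellMean (N j : ℕ) (ξ : ℝ) : ℂ :=
  (N : ℂ) ^ j * ∫ x in (0 : ℝ)..1 / (N : ℝ) ^ j, wave ξ x

theorem integral_wave_add (ξ a h : ℝ) :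
    ∫ x in a..(a + h), wave ξ x = wave ξ a * ∫ x in (0 : ℝ)..h, wave ξ x := by
  simpa only [add_zero, wave_add, intervalIntegral.integral_const_mul] using
    (intervalIntegral.integral_comp_add_left (a := 0) (b := h) (wave ξ) a).symm

theorem norm_integral_wave_le (hξ : ξ ≠ 0) (h : ℝ) :
    ‖∫ x in (0 : ℝ)..h, wave ξ x‖ ≤ |ξ|⁻¹ := by
  have hc : (-2 * Real.pi * Complex.I * ξ : ℂ) ≠ 0 := by simp [hξ, Real.pi_ne_zero]
  have hcnorm : ‖(-2 * Real.pi * Complex.I * ξ : ℂ)‖ = 2 * Real.pi * |ξ| := by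
    simp [Real.pi_pos.le]
  calc ‖∫ x in (0 : ℝ)..h, wave ξ x‖
      = ‖wave ξ h - wave ξ 0‖ / (2 * Real.pi * |ξ|) := by
        rw [← hcnorm, ← norm_div]
        exact congrArg _ (integral_exp_mul_complex hc)
    _ ≤ (1 + 1) / (2 * Real.pi * |ξ|) := by
        gcongr
        exact norm_sub_le_of_le (norm_wave ξ h).le (norm_wave ξ 0).le
    _ = Real.pi⁻¹ * |ξ|⁻¹ := by
        field_simp
        norm_num
    _ ≤ |ξ|⁻¹ := mul_le_of_le_one_left (by positivity)
        (inv_le_one_of_one_le₀ (by linarith [Real.pi_gt_three]))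

theorem norm_cellMean_le_one (N j : ℕ) (ξ : ℝ) : ‖cellMean N j ξ‖ ≤ 1 := by
  have hint : ‖∫ x in (0 : ℝ)..1 / (N : ℝ) ^ j, wave ξ x‖ ≤ 1 / (N : ℝ) ^ j := by
    simpa using intervalIntegral.norm_integral_le_of_norm_le_const (f := wave ξ) (C := 1)
      (a := 0) (b := 1 / (N : ℝ) ^ j) fun x _ => (norm_wave ξ x).le
  rw [cellMean, norm_mul, norm_pow, Complex.norm_natCast]
  calc (N : ℝ) ^ j * ‖∫ x in (0 : ℝ)..1 / (N : ℝ) ^ j, wave ξ x‖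
      ≤ (N : ℝ) ^ j * (1 / (N : ℝ) ^ j) := by gcongr
    _ ≤ 1 := by rw [one_div]; exact mul_inv_le_one

theorem norm_cellMean_le (hξ : ξ ≠ 0) (N j : ℕ) : ‖cellMean N j ξ‖ ≤ (N : ℝ) ^ j * |ξ|⁻¹ := by
  rw [cellMean, norm_mul, norm_pow, Complex.norm_natCast]
  gcongr
  exact norm_integral_wave_le hξ _

theorem norm_cellMean_le_rpow (hN : 0 < N) (hξ : ξ ≠ 0) (j : ℕ) {γ : ℝ} (hγ₀ : 0 ≤ γ)
    (hγ₁ : γ ≤ 1) : ‖cellMean N j ξ‖ ≤ ((N : ℝ) ^ γ) ^ j * |ξ| ^ (-γ) := by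
  have hξ₀ : 0 < |ξ| := abs_pos.2 hξ
  have hrpow : ((N : ℝ) ^ γ) ^ j * |ξ| ^ (-γ) = ((N : ℝ) ^ j * |ξ|⁻¹) ^ γ := by
    rw [Real.mul_rpow (by positivity) (by positivity), Real.rpow_neg hξ₀.le,
      Real.inv_rpow hξ₀.le, Real.rpow_pow_comm N.cast_nonneg]
  rw [hrpow]
  rcases le_total 1 ((N : ℝ) ^ j * |ξ|⁻¹) with h | h
  · exact (norm_cellMean_le_one N j ξ).trans (Real.one_le_rpow h hγ₀)
  · calc ‖cellMean N j ξ‖ ≤ (N : ℝ) ^ j * |ξ|⁻¹ := norm_cellMean_le hξ N j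
      _ ≤ ((N : ℝ) ^ j * |ξ|⁻¹) ^ γ := Real.self_le_rpow_of_le_one (by positivity) h hγ₁

theorem cellMean_eq_expect_mul (hN : 0 < N) (j : ℕ) (ξ : ℝ) : cellMean N j ξ =
    (𝔼 i ∈ range N, wave ξ (i / (N : ℝ) ^ (j + 1))) * cellMean N (j + 1) ξ := by
  have hN₀ : (N : ℂ) ≠ 0 := by exact_mod_cast hN.ne'
  have hlast : (N : ℝ) / (N : ℝ) ^ (j + 1) = 1 / (N : ℝ) ^ j := by
    rw [pow_succ', div_mul_cancel_left₀ (by positivity), one_div]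
  have hcells := intervalIntegral.sum_integral_adjacent_intervals (f := wave ξ) (n := N)
    (μ := volume) (a := fun i : ℕ => (i : ℝ) / (N : ℝ) ^ (j + 1))
    (fun _ _ => (continuous_wave ξ).intervalIntegrable _ _)
  simp only [hlast, Nat.cast_succ, add_div, integral_wave_add, Nat.cast_zero, zero_div,
    ← sum_mul] at hcells
  rw [cellMean, ← hcells, cellMean, expect_eq_sum_div_card, card_range, pow_succ]
  field_simp
  ring

end CellMean

section TreeTransform

variable {N t : ℕ} {ξ : ℝ}

/-- The Fourier transform of the measure that gives mass `t ^ (-j)`, uniformly distributed, to each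
interval `[m / N ^ j, (m + 1) / N ^ j]` with `m ∈ s`. -/
noncomputable def treeTransform (N t : ℕ) (s : Finset ℕ) (j : ℕ) (ξ : ℝ) : ℂ :=
  ((t : ℂ) ^ j)⁻¹ * (∑ m ∈ s, wave ξ (m / (N : ℝ) ^ j)) * cellMean N j ξ

theorem norm_treeTransform_le {s : Finset ℕ} {j : ℕ} (hs : #s ≤ t ^ j) (ξ : ℝ) :
    ‖treeTransform N t s j ξ‖ ≤ ‖cellMean N j ξ‖ := by
  have hsum : ‖∑ m ∈ s, wave ξ (m / (N : ℝ) ^ j)‖ ≤ (t : ℝ) ^ j :=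
    calc ‖∑ m ∈ s, wave ξ (m / (N : ℝ) ^ j)‖ ≤ ∑ m ∈ s, ‖wave ξ (m / (N : ℝ) ^ j)‖ :=
          norm_sum_le _ _
      _ = #s := by simp only [norm_wave, sum_const, nsmul_eq_mul, mul_one]
      _ ≤ (t : ℝ) ^ j := by exact_mod_cast hs
  rw [treeTransform, norm_mul, norm_mul, norm_inv, norm_pow, Complex.norm_natCast]
  exact mul_le_of_le_one_left (norm_nonneg _) (inv_mul_le_one_of_le₀ hsum (by positivity))

theorem treeTransform_children_sub (hN : 0 < N) {b : ℕ → Finset ℕ} (hb : ∀ m, b m ⊆ range N)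
    (hbt : ∀ m, #(b m) = t) (s : Finset ℕ) (j : ℕ) (ξ : ℝ) :
    treeTransform N t (children N b s) (j + 1) ξ - treeTransform N t s j ξ =
      ((t : ℂ) ^ j)⁻¹ * childDiscrepancy N b s j ξ * cellMean N (j + 1) ξ := by
  have hwave : ∀ u : Finset ℕ, ∀ m : ℕ,
      𝔼 i ∈ u, wave ξ ((N * m + i : ℕ) / (N : ℝ) ^ (j + 1)) =
        wave ξ (m / (N : ℝ) ^ j) * 𝔼 i ∈ u, wave ξ (i / (N : ℝ) ^ (j + 1)) := fun u m => by
    simp only [natCast_mul_add_div_pow_succ hN, wave_add, mul_expect]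
  have hchildren : ((t : ℂ) ^ (j + 1))⁻¹ *
      ∑ n ∈ children N b s, wave ξ (n / (N : ℝ) ^ (j + 1)) =
        ((t : ℂ) ^ j)⁻¹ * ∑ m ∈ s, 𝔼 i ∈ b m, wave ξ ((N * m + i : ℕ) / (N : ℝ) ^ (j + 1)) := by
    simp only [sum_children hb, expect_eq_sum_div_card, hbt, ← sum_div, pow_succ, mul_inv]
    ring
  rw [treeTransform, hchildren, treeTransform, cellMean_eq_expect_mul hN j]
  simp only [childDiscrepancy, discrepancy, sum_sub_distrib, hwave (range N), ← sum_mul]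
  ring

theorem norm_childDiscrepancy_le (hN : 0 < N) {b : ℕ → Finset ℕ} (hb : ∀ m, b m ⊆ range N)
    (hb₀ : ∀ m, (b m).Nonempty) (s : Finset ℕ) (j : ℕ) (ξ : ℝ) :
    ‖childDiscrepancy N b s j ξ‖ ≤ #s * (4 * Real.pi * |ξ| * (N : ℝ)⁻¹ ^ j) := by
  have hwave : ∀ m : ℕ, ∀ i ∈ range N,
      ‖wave ξ ((N * m + i : ℕ) / (N : ℝ) ^ (j + 1)) - wave ξ (m / (N : ℝ) ^ j)‖ ≤
        2 * Real.pi * |ξ| * (N : ℝ)⁻¹ ^ j := fun m i hi => by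
    rw [natCast_mul_add_div_pow_succ hN, wave_add, ← mul_sub_one, norm_mul, norm_wave, one_mul]
    refine (norm_wave_sub_one_le _ _).trans ?_
    gcongr
    rw [abs_of_nonneg (by positivity), inv_pow, inv_eq_one_div,
      div_le_div_iff₀ (by positivity) (by positivity), one_mul, pow_succ']
    gcongr
    exact (mem_range.1 hi).le
  calc ‖childDiscrepancy N b s j ξ‖ ≤ ∑ _m ∈ s, 2 * (2 * Real.pi * |ξ| * (N : ℝ)⁻¹ ^ j) :=
        norm_sum_le_of_le s fun m _ => norm_discrepancy_le (hb m) (hb₀ m) (hwave m)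
    _ = #s * (4 * Real.pi * |ξ| * (N : ℝ)⁻¹ ^ j) := by
        rw [sum_const, nsmul_eq_mul]
        ring

theorem norm_treeTransform_children_sub_le (hN : 0 < N) (ht : 0 < t) {b : ℕ → Finset ℕ}
    (hb : ∀ m, b m ⊆ range N) (hbt : ∀ m, #(b m) = t) {s : Finset ℕ} {j : ℕ}
    (hs : #s ≤ t ^ j) (ξ : ℝ) :
    ‖treeTransform N t (children N b s) (j + 1) ξ - treeTransform N t s j ξ‖ ≤
      4 * Real.pi * |ξ| * (N : ℝ)⁻¹ ^ j := by
  have hst : (#s : ℝ) ≤ (t : ℝ) ^ j := by exact_mod_cast hs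
  rw [treeTransform_children_sub hN hb hbt, norm_mul, norm_mul, norm_inv, norm_pow,
    Complex.norm_natCast]
  calc ((t : ℝ) ^ j)⁻¹ * ‖childDiscrepancy N b s j ξ‖ * ‖cellMean N (j + 1) ξ‖
      ≤ ((t : ℝ) ^ j)⁻¹ * ((t : ℝ) ^ j * (4 * Real.pi * |ξ| * (N : ℝ)⁻¹ ^ j)) * 1 := by
        gcongr
        · exact (norm_childDiscrepancy_le hN hb (fun m => card_pos.1 (hbt m ▸ ht)) s j ξ).trans
            (by gcongr)
        · exact norm_cellMean_le_one N (j + 1) ξ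
    _ = 4 * Real.pi * |ξ| * (N : ℝ)⁻¹ ^ j := by
        rw [mul_one, inv_mul_cancel_left₀ (by positivity)]

theorem norm_treeTransform_children_sub_le_rpow (hN : 0 < N) (ht : 0 < t) (hξ : ξ ≠ 0)
    {b : ℕ → Finset ℕ} (hb : ∀ m, b m ⊆ range N) (hbt : ∀ m, #(b m) = t) {s : Finset ℕ} {j : ℕ}
    {C : ℝ} (hC : 0 ≤ C) (hdisc : ‖childDiscrepancy N b s j ξ‖ ≤ C * ((j + 1) * √(t : ℝ) ^ j))
    {γ : ℝ} (hγ₀ : 0 ≤ γ) (hγ₁ : γ ≤ 1) :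
    ‖treeTransform N t (children N b s) (j + 1) ξ - treeTransform N t s j ξ‖ ≤
      C * (N : ℝ) ^ γ * ((j + 1) * ((N : ℝ) ^ γ / √(t : ℝ)) ^ j) * |ξ| ^ (-γ) := by
  have htj : (t : ℝ) ^ j = √(t : ℝ) ^ j * √(t : ℝ) ^ j := by
    rw [← mul_pow, Real.mul_self_sqrt t.cast_nonneg]
  rw [treeTransform_children_sub hN hb hbt, norm_mul, norm_mul, norm_inv, norm_pow,
    Complex.norm_natCast]
  calc ((t : ℝ) ^ j)⁻¹ * ‖childDiscrepancy N b s j ξ‖ * ‖cellMean N (j + 1) ξ‖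
      ≤ ((t : ℝ) ^ j)⁻¹ * (C * ((j + 1) * √(t : ℝ) ^ j)) *
          (((N : ℝ) ^ γ) ^ (j + 1) * |ξ| ^ (-γ)) := by
        gcongr
        exact norm_cellMean_le_rpow hN hξ (j + 1) hγ₀ hγ₁
    _ = C * (N : ℝ) ^ γ * ((j + 1) * ((N : ℝ) ^ γ / √(t : ℝ)) ^ j) * |ξ| ^ (-γ) := by
        rw [htj, div_pow, pow_succ]
        field_simp

theorem sum_succ_mul_pow_le {r : ℝ} (hr₀ : 0 ≤ r) (hr₁ : r < 1) (s : Finset ℕ) :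
    ∑ j ∈ s, ((j : ℝ) + 1) * r ^ j ≤ 1 / (1 - r) ^ 2 := by
  have h := hasSum_choose_mul_geometric_of_norm_lt_one 1
    (show ‖r‖ < 1 by rwa [Real.norm_of_nonneg hr₀])
  simp only [Nat.choose_one_right, Nat.cast_succ] at h
  exact sum_le_hasSum s (fun _ _ => by positivity) h

/-- The constant in the decay estimate with exponent `γ` for the descendants of a set of vertices of
level `l`, when the discrepancies of level `j` are at most `C * (j + 1) * √t ^ j`. -/
noncomputable def decayConst (N t : ℕ) (C γ : ℝ) (l : ℕ) : ℝ :=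
  ((N : ℝ) ^ γ) ^ l + C * (N : ℝ) ^ γ * (1 / (1 - (N : ℝ) ^ γ / √(t : ℝ)) ^ 2)

theorem norm_treeTransform_descendants_le (hN : 0 < N) {B : ℕ → ℕ → Finset ℕ}
    (hB : ∀ j m, B j m ⊆ range N) (hBt : ∀ j m, #(B j m) = t) {A : Finset ℕ} {l j : ℕ}
    (hlj : l ≤ j) (hξ : ξ ≠ 0) {C : ℝ} (hC : 0 ≤ C)
    (hdisc : ∀ i, l ≤ i →
      ‖childDiscrepancy N (B i) (descendants N B A l i) i ξ‖ ≤ C * ((i + 1) * √(t : ℝ) ^ i))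
    {γ : ℝ} (hγ₀ : 0 ≤ γ) (hγ₁ : γ ≤ 1) (hγ : (N : ℝ) ^ γ < √(t : ℝ)) :
    ‖treeTransform N t (descendants N B A l j) j ξ‖ ≤ decayConst N t C γ l * |ξ| ^ (-γ) := by
  have ht₀ : 0 < √(t : ℝ) := lt_of_le_of_lt (by positivity) hγ
  have ht : 0 < t := by exact_mod_cast Real.sqrt_pos.1 ht₀
  set F : ℕ → ℂ := fun i => treeTransform N t (descendants N B A l i) i ξ
  set c : ℕ → ℝ := fun i => (i + 1) * ((N : ℝ) ^ γ / √(t : ℝ)) ^ i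
  have hstart : ‖F l‖ ≤ ((N : ℝ) ^ γ) ^ l * |ξ| ^ (-γ) :=
    (norm_treeTransform_le (card_descendants_le hB hBt A l l) ξ).trans
      (norm_cellMean_le_rpow hN hξ l hγ₀ hγ₁)
  have htelescope : ‖F l - F j‖ ≤ ∑ i ∈ Ico l j, C * (N : ℝ) ^ γ * c i * |ξ| ^ (-γ) := by
    rw [← dist_eq_norm]
    refine dist_le_Ico_sum_of_dist_le hlj fun {i} hi _ => ?_
    dsimp only [F]
    rw [dist_comm, dist_eq_norm, descendants_succ hB A hi]
    exact norm_treeTransform_children_sub_le_rpow hN ht hξ (hB i) (hBt i) hC (hdisc i hi) hγ₀ hγ₁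
  calc ‖F j‖ ≤ ‖F l‖ + ‖F l - F j‖ := norm_le_norm_add_norm_sub _ _
    _ ≤ ((N : ℝ) ^ γ) ^ l * |ξ| ^ (-γ) + C * (N : ℝ) ^ γ * (∑ i ∈ Ico l j, c i) * |ξ| ^ (-γ) := by
        rw [mul_sum, sum_mul]
        exact add_le_add hstart htelescope
    _ ≤ decayConst N t C γ l * |ξ| ^ (-γ) := by
        rw [decayConst, add_mul]
        gcongr
        exact sum_succ_mul_pow_le (by positivity) ((div_lt_one ht₀).2 hγ) _

theorem rpow_half_lt_sqrt (hN : 1 < N) (ht : 0 < t) {β : ℝ}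
    (hβ : β < Real.log t / Real.log N) : (N : ℝ) ^ (β / 2) < √(t : ℝ) := by
  have ht₀ : (0 : ℝ) < t := by exact_mod_cast ht
  have hlog : 0 < Real.log N := Real.log_pos (by exact_mod_cast hN)
  rw [lt_div_iff₀ hlog] at hβ
  rw [← Real.log_lt_log_iff (by positivity) (by positivity), Real.log_rpow (by positivity),
    Real.log_sqrt ht₀.le]
  linarith

end TreeTransform

section LevelMeasure

variable {N t : ℕ} {D : ℕ → ℝ → Finset ℝ} {B : ℕ → ℕ → Finset ℕ}

theorem levelMeasure_eq_sum (N t : ℕ) (D : ℕ → ℝ → Finset ℝ) (j : ℕ) : levelMeasure N t D j =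
    ∑ a ∈ endpoints D j, ENNReal.ofReal (((t : ℝ) ^ j)⁻¹ * (N : ℝ) ^ j) •
      volume.restrict (Set.Icc a (a + 1 / (N : ℝ) ^ j)) := by
  have hdensity : ∀ x, ENNReal.ofReal (density N t D j x) = ∑ a ∈ endpoints D j,
      (Set.Icc a (a + 1 / (N : ℝ) ^ j)).indicator
        (fun _ => ENNReal.ofReal (((t : ℝ) ^ j)⁻¹ * (N : ℝ) ^ j)) x := fun x => by
    rw [density, ENNReal.ofReal_sum_of_nonneg fun a _ =>
      mul_nonneg (by positivity) (Set.indicator_nonneg (fun _ _ => zero_le_one) _)]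
    refine sum_congr rfl fun a _ => ?_
    simp only [Set.indicator_apply, mul_ite, mul_one, mul_zero, apply_ite ENNReal.ofReal,
      ENNReal.ofReal_zero]
  ext s hs
  simp only [levelMeasure, hdensity, withDensity_apply _ hs, Measure.finsetSum_apply]
  rw [lintegral_finsetSum _ fun a _ => measurable_const.indicator measurableSet_Icc]
  refine sum_congr rfl fun a _ => ?_
  rw [lintegral_indicator measurableSet_Icc, setLIntegral_const, Measure.smul_apply, smul_eq_mul,
    Measure.restrict_apply measurableSet_Icc, Measure.restrict_apply hs, Set.inter_comm]

theorem isProbabilityMeasure_levelMeasure (hN : 0 < N) (ht : 0 < t) {j : ℕ}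
    (hD : #(endpoints D j) = t ^ j) : IsProbabilityMeasure (levelMeasure N t D j) := by
  refine ⟨?_⟩
  simp only [levelMeasure_eq_sum, Measure.finsetSum_apply, Measure.smul_apply,
    Measure.restrict_apply_univ, Real.volume_Icc, add_sub_cancel_left, smul_eq_mul, sum_const, hD,
    nsmul_eq_mul]
  rw [← ENNReal.ofReal_mul (by positivity), ← ENNReal.ofReal_natCast,
    ← ENNReal.ofReal_mul (by positivity), ENNReal.ofReal_eq_one]
  push_cast
  field_simp

theorem levelMeasure_compl_level (N t : ℕ) (D : ℕ → ℝ → Finset ℝ) (j : ℕ) :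
    levelMeasure N t D j (level N D j)ᶜ = 0 := by
  rw [levelMeasure_eq_sum, Measure.finsetSum_apply]
  refine sum_eq_zero fun a ha => ?_
  have hcell : Set.Icc a (a + 1 / (N : ℝ) ^ j) ⊆ level N D j :=
    Set.subset_biUnion_of_mem (u := fun a => Set.Icc a (a + 1 / (N : ℝ) ^ j)) ha
  rw [Measure.smul_apply, Measure.restrict_apply (isCompact_level N D j).measurableSet.compl,
    (Set.disjoint_compl_left_iff_subset.2 hcell).inter_eq, measure_empty, smul_zero]

theorem integral_levelMeasure {E : Type*} [NormedAddCommGroup E] [NormedSpace ℝ E] {j : ℕ}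
    {g : ℝ → E} (hg : ∀ a ∈ endpoints D j, IntegrableOn g (Set.Icc a (a + 1 / (N : ℝ) ^ j))) :
    ∫ x, g x ∂(levelMeasure N t D j) = ∑ a ∈ endpoints D j,
      (((t : ℝ) ^ j)⁻¹ * (N : ℝ) ^ j) • ∫ x in Set.Ico a (a + 1 / (N : ℝ) ^ j), g x := by
  rw [levelMeasure_eq_sum,
    integral_finsetSum_measure fun a ha => (hg a ha).smul_measure ENNReal.ofReal_ne_top]
  refine sum_congr rfl fun a _ => ?_
  rw [integral_smul_measure, ENNReal.toReal_ofReal (by positivity), integral_Icc_eq_integral_Ico]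

theorem integral_Ico_wave (N j : ℕ) (a ξ : ℝ) :
    (((t : ℝ) ^ j)⁻¹ * (N : ℝ) ^ j) • ∫ x in Set.Ico a (a + 1 / (N : ℝ) ^ j), wave ξ x =
      ((t : ℂ) ^ j)⁻¹ * wave ξ a * cellMean N j ξ := by
  rw [← integral_Icc_eq_integral_Ico, integral_Icc_eq_integral_Ioc,
    ← intervalIntegral.integral_of_le (le_add_of_nonneg_right (by positivity)),
    integral_wave_add, cellMean, Complex.real_smul]
  push_cast
  ring

theorem fourierMeasure_levelMeasure (hN : 0 < N) (j : ℕ) (ξ : ℝ) :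
    fourierMeasure (levelMeasure N t (digitChoice N B) j) ξ =
      treeTransform N t (digitTree N B j) j ξ := by
  have hint := integral_levelMeasure (N := N) (t := t) (D := digitChoice N B) (j := j)
    (g := wave ξ) fun _ _ => (continuous_wave ξ).integrableOn_Icc
  simp only [integral_Ico_wave, endpoints_digitChoice hN,
    sum_image (div_pow_injective hN j).injOn, ← sum_mul, ← mul_sum] at hint
  exact hint

theorem measurableSet_structuredLevel (N : ℕ) (P : Finset ℕ) (l : ℕ) :
    MeasurableSet (structuredLevel N P l) :=
  Finset.measurableSet_biUnion _ fun _ _ => measurableSet_Ico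

theorem charFn_mul_wave (N : ℕ) (P : Finset ℕ) (l : ℕ) (ξ : ℝ) :
    (fun x => (charFn N P l x : ℂ) * wave ξ x) = (structuredLevel N P l).indicator (wave ξ) := by
  ext x
  by_cases hx : x ∈ structuredLevel N P l <;> simp [charFn, hx]

theorem setIntegral_charFn_mul_wave (hN : 0 < N) (P : Finset ℕ) {l j : ℕ} (hl : l ≤ j) (m : ℕ)
    (ξ : ℝ) :
    ∫ x in Set.Ico (m / (N : ℝ) ^ j) (m / (N : ℝ) ^ j + 1 / (N : ℝ) ^ j),
        (charFn N P l x : ℂ) * wave ξ x =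
      if m / N ^ (j - l) ∈ digitTree N (fun _ _ => P) l then
        ∫ x in Set.Ico (m / (N : ℝ) ^ j) (m / (N : ℝ) ^ j + 1 / (N : ℝ) ^ j), wave ξ x
      else 0 := by
  rw [charFn_mul_wave]
  split_ifs with hm
  · exact setIntegral_congr_fun measurableSet_Ico fun x hx =>
      Set.indicator_of_mem ((mem_structuredLevel_iff hN P hl hx).2 hm) _
  · exact setIntegral_eq_zero_of_forall_eq_zero fun x hx =>
      Set.indicator_of_notMem (mt (mem_structuredLevel_iff hN P hl hx).1 hm) _

theorem fourierWeighted_levelMeasure (hN : 0 < N) (P : Finset ℕ) {l j : ℕ} (hl : l ≤ j) (ξ : ℝ) :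
    fourierWeighted (charFn N P l) (levelMeasure N t (digitChoice N B) j) ξ =
      treeTransform N t (descendants N B (digitTree N (fun _ _ => P) l) l j) j ξ := by
  have hint := integral_levelMeasure (N := N) (t := t) (D := digitChoice N B) (j := j)
    (g := fun x => (charFn N P l x : ℂ) * wave ξ x) fun a _ => by
      rw [charFn_mul_wave]
      exact (continuous_wave ξ).integrableOn_Icc.indicator (measurableSet_structuredLevel N P l)
  simp only [endpoints_digitChoice hN, sum_image (div_pow_injective hN j).injOn,
    setIntegral_charFn_mul_wave hN P hl, smul_ite, smul_zero, ← sum_filter, integral_Ico_wave,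
    ← sum_mul, ← mul_sum] at hint
  exact hint

theorem exists_tendsto_fourierMeasure_levelMeasure (hN : 1 < N) (ht : 0 < t)
    (hB : ∀ j m, B j m ⊆ range N) (hBt : ∀ j m, #(B j m) = t) (ξ : ℝ) :
    ∃ z, Tendsto (fun j => fourierMeasure (levelMeasure N t (digitChoice N B) j) ξ) atTop
      (𝓝 z) := by
  simp only [fourierMeasure_levelMeasure (zero_lt_one.trans hN)]
  refine cauchySeq_tendsto_of_complete (cauchySeq_of_le_geometric (N : ℝ)⁻¹
    (4 * Real.pi * |ξ|) (inv_lt_one_of_one_lt₀ (by exact_mod_cast hN)) fun j => ?_)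
  rw [dist_comm, dist_eq_norm]
  exact norm_treeTransform_children_sub_le (zero_lt_one.trans hN) ht (hB j) (hBt j)
    (card_digitTree hB hBt j).le ξ

end LevelMeasure

section WeakLimit

theorem exists_tendsto_of_tendsto_charFun {E : Type*} [NormedAddCommGroup E]
    [InnerProductSpace ℝ E] [FiniteDimensional ℝ E] [MeasurableSpace E] [BorelSpace E]
    {ν : ℕ → ProbabilityMeasure E}
    (hν : IsTightMeasureSet {((μ : ProbabilityMeasure E) : Measure E) | μ ∈ Set.range ν})
    (h : ∀ ξ, ∃ z, Tendsto (fun n => charFun (ν n : Measure E) ξ) atTop (𝓝 z)) :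
    ∃ μ, Tendsto ν atTop (𝓝 μ) := by
  obtain ⟨μ, -, φ, hφ, hμ⟩ := (isCompact_closure_of_isTightMeasureSet hν).tendsto_subseq
    fun n => subset_closure (Set.mem_range_self n)
  refine ⟨μ, ProbabilityMeasure.tendsto_of_tendsto_charFun fun ξ => ?_⟩
  obtain ⟨z, hz⟩ := h ξ
  have hsubseq := ProbabilityMeasure.tendsto_iff_tendsto_charFun.1 hμ ξ
  rwa [tendsto_nhds_unique hsubseq (hz.comp hφ.tendsto_atTop)]

theorem measure_compl_eq_zero_of_tendsto {Ω ι : Type*} [MeasurableSpace Ω] [TopologicalSpace Ω]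
    [OpensMeasurableSpace Ω] [HasOuterApproxClosed Ω] {L : Filter ι} [L.NeBot]
    {ν : ι → ProbabilityMeasure Ω} {μ : ProbabilityMeasure Ω} (h : Tendsto ν L (𝓝 μ)) {K : Set Ω}
    (hK : IsClosed K) (hν : ∀ᶠ i in L, (ν i : Measure Ω) Kᶜ = 0) : (μ : Measure Ω) Kᶜ = 0 :=
  nonpos_iff_eq_zero.1 <|
    calc (μ : Measure Ω) Kᶜ ≤ L.liminf fun i => (ν i : Measure Ω) Kᶜ :=
          ProbabilityMeasure.le_liminf_measure_open_of_tendsto h hK.isOpen_compl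
      _ = 0 := ((tendsto_congr' hν).2 tendsto_const_nhds).liminf_eq

theorem fourierMeasure_eq_charFun (ν : Measure ℝ) (ξ : ℝ) :
    fourierMeasure ν ξ = charFun ν (-2 * Real.pi * ξ) := by
  rw [charFun_apply_real]
  exact integral_congr_ae (.of_forall fun x => by push_cast; ring_nf)

theorem exists_isWeakLimit {ν : ℕ → Measure ℝ} [∀ j, IsProbabilityMeasure (ν j)] {K : ℕ → Set ℝ}
    (hK : ∀ j, IsCompact (K j)) (hanti : Antitone K) (hνK : ∀ j, ν j (K j)ᶜ = 0)
    (h : ∀ ξ, ∃ z, Tendsto (fun j => fourierMeasure (ν j) ξ) atTop (𝓝 z)) :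
    ∃ μ : Measure ℝ, IsProbabilityMeasure μ ∧ IsWeakLimit ν μ ∧ μ (⋂ j, K j)ᶜ = 0 ∧
      ∀ ξ, Tendsto (fun j => fourierMeasure (ν j) ξ) atTop (𝓝 (fourierMeasure μ ξ)) := by
  let ν' : ℕ → ProbabilityMeasure ℝ := fun j => ⟨ν j, inferInstance⟩
  have hsupp : ∀ i j, i ≤ j → ν j (K i)ᶜ = 0 := fun i j hij =>
    measure_mono_null (Set.compl_subset_compl.2 (hanti hij)) (hνK j)
  have htight : IsTightMeasureSet
      {((μ : ProbabilityMeasure ℝ) : Measure ℝ) | μ ∈ Set.range ν'} := by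
    refine isTightMeasureSet_iff_exists_isCompact_measure_compl_le.2 fun ε _ => ⟨K 0, hK 0, ?_⟩
    rintro _ ⟨_, ⟨j, rfl⟩, rfl⟩
    exact (hsupp 0 j j.zero_le).trans_le zero_le
  have hcharFun : ∀ ξ, ∃ z, Tendsto (fun j => charFun (ν' j : Measure ℝ) ξ) atTop (𝓝 z) := by
    intro ξ
    have hξ := h (ξ / (-2 * Real.pi))
    simp only [fourierMeasure_eq_charFun,
      mul_div_cancel₀ ξ (show -2 * Real.pi ≠ 0 by simp [Real.pi_ne_zero])] at hξ
    exact hξ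
  obtain ⟨μ, hμ⟩ := exists_tendsto_of_tendsto_charFun htight hcharFun
  refine ⟨μ, inferInstance, ProbabilityMeasure.tendsto_iff_forall_integral_tendsto.1 hμ, ?_,
    fun ξ => ?_⟩
  · rw [Set.compl_iInter]
    exact measure_iUnion_null fun i => measure_compl_eq_zero_of_tendsto hμ (hK i).isClosed
      (eventually_atTop.2 ⟨i, hsupp i⟩)
  · simp only [fourierMeasure_eq_charFun]
    exact ProbabilityMeasure.tendsto_iff_tendsto_charFun.1 hμ _

theorem exists_isWeakLimit_levelMeasure {N t : ℕ} (hN : 1 < N) (ht : 0 < t)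
    {B : ℕ → ℕ → Finset ℕ} (hB : ∀ j m, B j m ⊆ range N) (hBt : ∀ j m, #(B j m) = t) :
    ∃ μ : Measure ℝ, IsProbabilityMeasure μ ∧ IsWeakLimit (levelMeasure N t (digitChoice N B)) μ ∧
      μ (cantorSet N (digitChoice N B))ᶜ = 0 ∧
      ∀ ξ, Tendsto (fun j => treeTransform N t (digitTree N B j) j ξ) atTop
        (𝓝 (fourierMeasure μ ξ)) := by
  have hN₀ : 0 < N := zero_lt_one.trans hN
  have hprob : ∀ j, IsProbabilityMeasure (levelMeasure N t (digitChoice N B) j) := fun j =>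
    isProbabilityMeasure_levelMeasure hN₀ ht (card_endpoints_digitChoice hN₀ hB hBt j)
  obtain ⟨μ, hμ, hweak, hsupp, hlim⟩ := exists_isWeakLimit (isCompact_level N _)
    (antitone_level_digitChoice hN₀ hB) (levelMeasure_compl_level N t _)
    (exists_tendsto_fourierMeasure_levelMeasure hN ht hB hBt)
  have hcantor : ⋂ j, level N (digitChoice N B) j ⊆ cantorSet N (digitChoice N B) :=
    Set.subset_iInter₂ fun j _ => Set.iInter_subset _ j
  exact ⟨μ, hμ, hweak, measure_mono_null (Set.compl_subset_compl.2 hcantor) hsupp,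
    by simpa only [fourierMeasure_levelMeasure hN₀] using hlim⟩

end WeakLimit

section Parameters

theorem log_div_log_le_one {t N : ℕ} (htN : t ≤ N) : Real.log t / Real.log N ≤ 1 := by
  obtain rfl | ht := t.eq_zero_or_pos
  · simp
  · exact div_le_one_of_le₀ (Real.log_le_log (by exact_mod_cast ht) (by exact_mod_cast htN))
      (Real.log_natCast_nonneg N)

theorem log_natCast_pow_div_log_natCast_pow {n : ℕ} (hn : n ≠ 0) (t N : ℕ) :
    Real.log (t ^ n : ℕ) / Real.log (N ^ n : ℕ) = Real.log t / Real.log N := by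
  rw [Nat.cast_pow, Nat.cast_pow, Real.log_pow, Real.log_pow,
    mul_div_mul_left _ _ (Nat.cast_ne_zero.2 hn)]

theorem IsArithProg.card_eq {P : Finset ℕ} {L : ℕ} (hP : IsArithProg P L) : #P = L := by
  obtain ⟨x, d, hd, rfl⟩ := hP
  rw [card_image_of_injective _ fun i i' h => Nat.eq_of_mul_eq_mul_right hd (Nat.add_left_cancel h),
    card_range]

theorem card_digitTree_const_le {N t : ℕ} {P : Finset ℕ} (hPN : P ⊆ range N) (hPt : #P ^ 2 ≤ t)
    (j : ℕ) : (#(digitTree N (fun _ _ => P) j) : ℝ) ≤ √(t : ℝ) ^ j := by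
  rw [card_digitTree (fun _ _ => hPN) (fun _ _ => rfl), Nat.cast_pow]
  gcongr
  exact Real.le_sqrt_of_sq_le (by exact_mod_cast hPt)

end Parameters

end SalemCantor

open SalemCantor in
theorem proposition2p2_general {N t : ℕ} (hN : 1 < N) (ht : 0 < t) (htN : t ≤ N) :
    ∃ (C₁ : ℝ → ℝ) (C₂ : ℝ → ℕ → ℝ), ∀ P ⊆ Finset.range N, P.card ^ 2 ≤ t →
      ∃ D : ℕ → ℝ → Finset ℝ, IsAdmissible N t D ∧
        (∀ j, structured N P j ⊆ endpoints D j ∧ structuredLevel N P j ⊆ level N D j) ∧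
        ∃ μ : Measure ℝ, IsProbabilityMeasure μ ∧ IsWeakLimit (levelMeasure N t D) μ ∧
          μ (cantorSet N D)ᶜ = 0 ∧
          ∀ β : ℝ, 0 < β → β < Real.log t / Real.log N →
            (∀ k : ℤ, k ≠ 0 → ‖fourierMeasure μ k‖ ≤ C₁ β * |(k : ℝ)| ^ (-(β / 2))) ∧
            (∀ l j : ℕ, l ≤ j → ∀ k : ℤ, k ≠ 0 →
              ‖fourierWeighted (charFn N P l) (levelMeasure N t D j) k‖ ≤
                C₂ β l * |(k : ℝ)| ^ (-(β / 2))) := by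
  have hN₀ : 0 < N := zero_lt_one.trans hN
  set C : ℝ := 12 + 4 * Real.log N
  have hC : 0 ≤ C := by positivity
  refine ⟨fun β => decayConst N t C (β / 2) 0, fun β l => decayConst N t C (β / 2) l,
    fun P hPN hPt => ?_⟩
  obtain ⟨B, hB, hBt, hPB, hdisc⟩ := exists_digitTree_norm_childDiscrepancy_le ht htN hPN
    ((Nat.le_self_pow two_ne_zero _).trans hPt) (card_digitTree_const_le hPN hPt)
  obtain ⟨μ, hμ, hweak, hsupp, hlim⟩ := exists_isWeakLimit_levelMeasure hN ht hB hBt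
  have hsub := structured_subset_endpoints hN₀ hPB
  refine ⟨digitChoice N B, isAdmissible_digitChoice hN₀ hB hBt,
    fun j => ⟨hsub j, structuredLevel_subset_level (hsub j)⟩, μ, hμ, hweak, hsupp,
    fun β hβ₀ hβ => ?_⟩
  have hβ₁ : β / 2 ≤ 1 := by linarith [log_div_log_le_one htN]
  have hdecay := fun l j (hlj : l ≤ j) (k : ℤ) (hk : k ≠ 0) =>
    norm_treeTransform_descendants_le hN₀ hB hBt (A := digitTree N (fun _ _ => P) l) hlj
      (Int.cast_ne_zero.2 hk) hC (fun i hi => hdisc l i hi k) (half_pos hβ₀).le hβ₁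
      (rpow_half_lt_sqrt hN ht hβ)
  refine ⟨fun k hk => le_of_tendsto (hlim k).norm (.of_forall fun j => ?_), fun l j hlj k hk => ?_⟩
  · rw [← descendants_zero hB j]
    exact hdecay 0 j j.zero_le k hk
  · rw [fourierWeighted_levelMeasure hN₀ P hlj]
    exact hdecay l j hlj k hk

theorem proposition2p2 (N₀ t₀ : ℕ) (ht₀ : 1 < t₀) (htN : t₀ < N₀) :
    ∃ m : ℕ, ∀ n₀ : ℕ, m ≤ n₀ →
      ∃ (C₁ : ℝ → ℝ) (C₂ : ℝ → ℕ → ℝ),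
        ∀ P : Finset ℕ, SalemCantor.IsArithProg P (t₀ ^ n₀) →
          P ⊆ Finset.range (N₀ ^ (2 * n₀)) →
          ∃ D : ℕ → ℝ → Finset ℝ,
            SalemCantor.IsAdmissible (N₀ ^ (2 * n₀)) (t₀ ^ (2 * n₀)) D ∧
            (∀ j : ℕ,
              SalemCantor.structured (N₀ ^ (2 * n₀)) P j ⊆ SalemCantor.endpoints D j ∧
              SalemCantor.structuredLevel (N₀ ^ (2 * n₀)) P j ⊆
                SalemCantor.level (N₀ ^ (2 * n₀)) D j) ∧
            ∃ μ : Measure ℝ, IsProbabilityMeasure μ ∧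
              SalemCantor.IsWeakLimit
                (SalemCantor.levelMeasure (N₀ ^ (2 * n₀)) (t₀ ^ (2 * n₀)) D) μ ∧
              μ (SalemCantor.cantorSet (N₀ ^ (2 * n₀)) D)ᶜ = 0 ∧
              ∀ β : ℝ, 0 < β → β < Real.log t₀ / Real.log N₀ →
                (∀ k : ℤ, k ≠ 0 →
                  ‖SalemCantor.fourierMeasure μ k‖ ≤ C₁ β * |(k : ℝ)| ^ (-(β / 2))) ∧
                (∀ l j : ℕ, l ≤ j → ∀ k : ℤ, k ≠ 0 →
                  ‖SalemCantor.fourierWeighted (SalemCantor.charFn (N₀ ^ (2 * n₀)) P l)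
                      (SalemCantor.levelMeasure (N₀ ^ (2 * n₀)) (t₀ ^ (2 * n₀)) D j) k‖ ≤
                    C₂ β l * |(k : ℝ)| ^ (-(β / 2))) := by
  refine ⟨1, fun n₀ hn₀ => ?_⟩
  obtain ⟨C₁, C₂, h⟩ := proposition2p2_general (N := N₀ ^ (2 * n₀)) (t := t₀ ^ (2 * n₀))
    (Nat.one_lt_pow (by lia) (ht₀.trans htN)) (by positivity) (Nat.pow_le_pow_left htN.le _)
  rw [SalemCantor.log_natCast_pow_div_log_natCast_pow (by lia)] at h
  exact ⟨C₁, C₂, fun P hP hPN => h P hPN (by rw [hP.card_eq, ← pow_mul, mul_comm])⟩
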